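/- Let $q\in\mathbb R$ with $0<|q|<1$. Let $P(S^2_{q\infty})$ be the unital $*$-algebra over $\mathbb C$ generated by $A,B$ subject to $$A^*=A,\quad BA=q^2AB,\quad B^*B=1-A^2,\quad BB^*=1-q^4A^2,$$ and let $C(S^2_{q\infty})$ be its $C^*$-completion, i.e. its completion with respect to the norm $a\mapsto\sup_\pi\|\pi(a)\|$, where $\pi$ runs over all $*$-representations by bounded operators on Hilbert spaces. Let $r_2$ be the $*$-automorphism of $P(S^2_{q\infty})$ with $r_2(A)=-A$, $r_2(B)=-B$, let $\bar r_2$ be its continuous extension to $C(S^2_{q\infty})$, and put $$P(\mathbb RP^2_q)=\{a\in P(S^2_{q\infty}) : r_2(a)=a\},\qquad C(\mathbb RP^2_q)=\{a\in C(S^2_{q\infty}) : \bar r_2(a)=a\},$$ the latter with the norm inherited from $C(S^2_{q\infty})$. Then $C(\mathbb RP^2_q)$, together with the canonical $*$-homomorphism $\iota:P(\mathbb RP^2_q)\to C(\mathbb RP^2_q)$, is the universal $C^*$-algebra of $P(\mathbb RP^2_q)$. That is: 1. $\iota$ has dense range; 2. for every $a\in P(\mathbb RP^2_q)$, the inherited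 norm $\|\iota(a)\|$ is the supremum of $\|\pi(a)\|$ over all $*$-representations $\pi$ of $P(\mathbb RP^2_q)$ by bounded operators on Hilbert spaces (so $C(\mathbb RP^2_q)$ is the $C^*$-completion of $P(\mathbb RP^2_q)$); 3. for every unital $C^*$-algebra $D$ and every unital $*$-homomorphism $\varphi:P(\mathbb RP^2_q)\to D$ there is a unique unital $*$-homomorphism $\Phi:C(\mathbb RP^2_q)\to D$ with $\Phi\circ\iota=\varphi$. -/

import Mathlib

universe u v

noncomputable section

/-! ### The free `*`-algebra -/

/-- The free unital `*`-algebra over `ℂ` on a set `X`: the free algebra on two copies of `X`,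
the second copy playing the role of the adjoints of the elements of the first copy. -/
def FreeStarAlg (X : Type u) : Type u := FreeAlgebra ℂ (X ⊕ X)

namespace FreeStarAlg

variable {X : Type u}

instance : Ring (FreeStarAlg X) := inferInstanceAs (Ring (FreeAlgebra ℂ (X ⊕ X)))

instance : Algebra ℂ (FreeStarAlg X) := inferInstanceAs (Algebra ℂ (FreeAlgebra ℂ (X ⊕ X)))

/-- The generator `x` (for `Sum.inl x`) or its adjoint `x*` (for `Sum.inr x`). -/
def letter (y : X ⊕ X) : FreeStarAlg X := FreeAlgebra.ι ℂ y

/-- The generator attached to `x`. -/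
def gen (x : X) : FreeStarAlg X := letter (Sum.inl x)

/-- Extension of a function on the letters to an algebra homomorphism. -/
def lift {C : Type v} [Ring C] [Algebra ℂ C] (f : X ⊕ X → C) : FreeStarAlg X →ₐ[ℂ] C :=
  FreeAlgebra.lift ℂ f

@[simp] theorem lift_letter {C : Type v} [Ring C] [Algebra ℂ C] (f : X ⊕ X → C) (y : X ⊕ X) :
    lift f (letter y) = f y :=
  FreeAlgebra.lift_ι_apply f y

theorem induction {p : FreeStarAlg X → Prop} (h0 : ∀ r : ℂ, p (algebraMap ℂ _ r))
    (h1 : ∀ y, p (letter y)) (h2 : ∀ a b, p a → p b → p (a * b))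
    (h3 : ∀ a b, p a → p b → p (a + b)) (a : FreeStarAlg X) : p a :=
  FreeAlgebra.induction ℂ (X ⊕ X) h0 h1 h2 h3 a

/-- The opposite algebra with the conjugate scalar multiplication. -/
@[reducible] def conjAlgebra (C : Type v) [Ring C] [Algebra ℂ C] : Algebra ℂ Cᵐᵒᵖ :=
  Algebra.compHom Cᵐᵒᵖ (starRingEnd ℂ)

/-- The involution of the free `*`-algebra as a ring homomorphism to the opposite ring. -/
def starHom : FreeStarAlg X →+* (FreeStarAlg X)ᵐᵒᵖ :=
  letI := conjAlgebra (FreeStarAlg X)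
  AlgHom.toRingHom (FreeAlgebra.lift ℂ (A := (FreeStarAlg X)ᵐᵒᵖ)
    (fun y : X ⊕ X => MulOpposite.op (letter y.swap)))

theorem starHom_letter (y : X ⊕ X) :
    starHom (letter y) = MulOpposite.op (letter y.swap) :=
  letI := conjAlgebra (FreeStarAlg X)
  FreeAlgebra.lift_ι_apply (R := ℂ) (A := (FreeStarAlg X)ᵐᵒᵖ)
    (fun y : X ⊕ X => MulOpposite.op (letter y.swap)) y

theorem starHom_algebraMap (r : ℂ) :
    starHom (algebraMap ℂ (FreeStarAlg X) r)
      = MulOpposite.op (algebraMap ℂ (FreeStarAlg X) (star r)) :=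
  letI := conjAlgebra (FreeStarAlg X)
  AlgHom.commutes (FreeAlgebra.lift ℂ (A := (FreeStarAlg X)ᵐᵒᵖ)
    (fun y : X ⊕ X => MulOpposite.op (letter y.swap))) r

instance : StarRing (FreeStarAlg X) where
  star a := (starHom a).unop
  star_involutive a := by
    induction a using induction with
    | h0 r => simp [starHom_algebraMap]
    | h1 y => simp [starHom_letter]
    | h2 a b ha hb => simp [ha, hb]
    | h3 a b ha hb => simp [ha, hb]
  star_mul a b := by simp
  star_add a b := by simp

theorem star_def (a : FreeStarAlg X) : star a = (starHom a).unop := rfl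

@[simp] theorem star_letter (y : X ⊕ X) : star (letter y) = letter y.swap := by
  simp [star_def, starHom_letter]

instance : StarModule ℂ (FreeStarAlg X) where
  star_smul r a := by
    simp only [star_def, Algebra.smul_def, map_mul, starHom_algebraMap, MulOpposite.unop_mul,
      MulOpposite.unop_op]
    exact (Algebra.commutes _ _).symm

end FreeStarAlg

/-! ### The universal `C*`-norm and the `C*`-completion of a `*`-algebra -/

section Completion

variable (P : Type u) [Ring P] [StarRing P] [Algebra ℂ P] [StarModule ℂ P]

/-- A (unital) `*`-representation of `P` by bounded operators on a complex Hilbert space. -/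
structure BoundedRep where
  /-- The Hilbert space. -/
  H : Type u
  [normedAddCommGroup : NormedAddCommGroup H]
  [innerProductSpace : InnerProductSpace ℂ H]
  [completeSpace : CompleteSpace H]
  /-- The action. -/
  π : P →⋆ₐ[ℂ] (H →L[ℂ] H)

attribute [instance] BoundedRep.normedAddCommGroup BoundedRep.innerProductSpace
  BoundedRep.completeSpace

/-- For every `a` the norms of `a` in all bounded `*`-representations are bounded. -/
class IsCStarBounded : Prop where
  bdd : ∀ a : P, BddAbove (Set.range fun ρ : BoundedRep P => ‖ρ.π a‖)

variable {P}

/-- The supremum norm over all bounded `*`-representations. -/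
def universalNorm (a : P) : ℝ := ⨆ ρ : BoundedRep P, ‖ρ.π a‖

variable (P) in
/-- The representation on the zero space. -/
def BoundedRep.trivial : BoundedRep P where
  H := PUnit
  π :=
    { toFun := fun _ => 0
      map_one' := Subsingleton.elim _ _
      map_mul' := fun _ _ => Subsingleton.elim _ _
      map_zero' := rfl
      map_add' := fun _ _ => Subsingleton.elim _ _
      commutes' := fun _ => Subsingleton.elim _ _
      map_star' := fun _ => Subsingleton.elim _ _ }

instance : Nonempty (BoundedRep P) := ⟨BoundedRep.trivial P⟩

theorem universalNorm_nonneg (a : P) : 0 ≤ universalNorm a :=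
  Real.iSup_nonneg fun _ => norm_nonneg _

section

variable [IsCStarBounded P]

theorem BoundedRep.norm_le (ρ : BoundedRep P) (a : P) : ‖ρ.π a‖ ≤ universalNorm a :=
  le_ciSup (IsCStarBounded.bdd a) ρ

theorem universalNorm_star_mul_self (a : P) :
    universalNorm a * universalNorm a = universalNorm (star a * a) := by
  have h : ∀ ρ : BoundedRep P, ‖ρ.π (star a * a)‖ = ‖ρ.π a‖ * ‖ρ.π a‖ := fun ρ => by
    rw [map_mul, map_star, CStarRing.norm_star_mul_self]
  apply le_antisymm
  · have h1 : universalNorm a ≤ √(universalNorm (star a * a)) := ciSup_le fun ρ => by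
      apply Real.le_sqrt_of_sq_le
      rw [sq, ← h ρ]
      exact ρ.norm_le _
    calc _ ≤ √(universalNorm (star a * a)) * √(universalNorm (star a * a)) :=
          mul_self_le_mul_self (universalNorm_nonneg a) h1
      _ = _ := Real.mul_self_sqrt (universalNorm_nonneg _)
  · refine ciSup_le fun ρ => ?_
    rw [h ρ]
    exact mul_self_le_mul_self (norm_nonneg _) (ρ.norm_le a)

variable (P) in
/-- The universal norm as a seminorm on the ring `P`. -/
def universalRingSeminorm : RingSeminorm P where
  toFun := universalNorm
  map_zero' := by simp [universalNorm]
  add_le' a b := ciSup_le fun ρ => by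
    rw [map_add]
    exact (norm_add_le _ _).trans (add_le_add (ρ.norm_le a) (ρ.norm_le b))
  neg' a := by simp [universalNorm]
  mul_le' a b := ciSup_le fun ρ => by
    rw [map_mul]
    exact (norm_mul_le _ _).trans
      (mul_le_mul (ρ.norm_le a) (ρ.norm_le b) (norm_nonneg _) (universalNorm_nonneg a))

end

variable (P) in
/-- A copy of `P` carrying the universal norm. -/
def PreCStar : Type u := P

namespace PreCStar

instance : Ring (PreCStar P) := inferInstanceAs (Ring P)
instance : StarRing (PreCStar P) := inferInstanceAs (StarRing P)
instance : Algebra ℂ (PreCStar P) := inferInstanceAs (Algebra ℂ P)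
instance : StarModule ℂ (PreCStar P) := inferInstanceAs (StarModule ℂ P)

variable [IsCStarBounded P]

instance : SeminormedRing (PreCStar P) :=
  RingSeminorm.toSeminormedRing (R := PreCStar P) (universalRingSeminorm P)

theorem norm_def (a : PreCStar P) : ‖a‖ = universalNorm (P := P) a := rfl

instance : NormedAlgebra ℂ (PreCStar P) where
  norm_smul_le r a := ciSup_le fun ρ : BoundedRep P => by
    have : ρ.π (r • a : P) = r • ρ.π (a : P) := map_smul ρ.π r (a : P)
    change ‖ρ.π (r • a : P)‖ ≤ _
    rw [this]
    exact (norm_smul_le _ _).trans (mul_le_mul_of_nonneg_left (ρ.norm_le a) (norm_nonneg r))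

instance : NormedStarGroup (PreCStar P) where
  norm_star_le a := ciSup_le fun ρ : BoundedRep P => by
    have h : ρ.π (star a : P) = star (ρ.π (a : P)) := map_star ρ.π (a : P)
    have h1 : ‖ρ.π (star a : P)‖ = ‖ρ.π (a : P)‖ := by rw [h, norm_star]
    exact h1.le.trans (ρ.norm_le a)

end PreCStar

variable (P) in
/-- The `C*`-completion of `P`: the (Hausdorff) completion with respect to the supremum norm over
all bounded `*`-representations. -/
abbrev CStarCompletion [IsCStarBounded P] : Type u := UniformSpace.Completion (PreCStar P)

namespace CStarCompletion

open UniformSpace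

variable [IsCStarBounded P]

instance : NormedAlgebra ℂ (CStarCompletion P) where
  norm_smul_le := norm_smul_le

/-- The canonical map on the level of rings. -/
def coe : P →ₐ[ℂ] CStarCompletion P where
  toFun a := Completion.coe' (α := PreCStar P) a
  map_one' := Completion.coe_one (PreCStar P)
  map_zero' := Completion.coe_zero
  map_mul' := Completion.coe_mul (α := PreCStar P)
  map_add' := Completion.coe_add (α := PreCStar P)
  commutes' _ := rfl

theorem denseRange_coe : DenseRange (coe : P → CStarCompletion P) :=
  Completion.denseRange_coe (α := PreCStar P)

theorem norm_coe (a : P) : ‖(coe a : CStarCompletion P)‖ = universalNorm a :=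
  Completion.norm_coe (E := PreCStar P) a

theorem induction {p : CStarCompletion P → Prop} (a : CStarCompletion P)
    (hp : IsClosed {a | p a}) (h : ∀ a : P, p (coe a)) : p a :=
  denseRange_coe.induction_on a hp h

/-- The star operation, extended by continuity. -/
def starFun : CStarCompletion P → CStarCompletion P :=
  Completion.map (star : PreCStar P → PreCStar P)

theorem continuous_starFun : Continuous (starFun : CStarCompletion P → CStarCompletion P) :=
  Completion.continuous_map

theorem starFun_coe (a : P) : starFun (coe a : CStarCompletion P) = coe (star a) :=
  Completion.map_coe (star_isometry (E := PreCStar P)).uniformContinuous a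

instance : StarRing (CStarCompletion P) where
  star := starFun
  star_involutive a := by
    induction a using induction with
    | hp => exact isClosed_eq (continuous_starFun.comp continuous_starFun) continuous_id
    | h a => rw [starFun_coe, starFun_coe, star_star]
  star_mul a b := by
    refine denseRange_coe.induction_on₂ (p := fun a b => starFun (a * b) = starFun b * starFun a)
      ?_ ?_ a b
    · have := continuous_starFun (P := P)
      exact isClosed_eq (by fun_prop) (by fun_prop)
    · intro a b
      rw [← map_mul, starFun_coe, starFun_coe, starFun_coe, star_mul, map_mul]
  star_add a b := by
    refine denseRange_coe.induction_on₂ (p := fun a b => starFun (a + b) = starFun a + starFun b)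
      ?_ ?_ a b
    · have := continuous_starFun (P := P)
      exact isClosed_eq (by fun_prop) (by fun_prop)
    · intro a b
      rw [← map_add, starFun_coe, starFun_coe, starFun_coe, star_add, map_add]

instance : ContinuousStar (CStarCompletion P) := ⟨continuous_starFun⟩

theorem star_coe (a : P) : star (coe a : CStarCompletion P) = coe (star a) := starFun_coe a

theorem coe_smul (r : ℂ) (a : P) : (coe (r • a) : CStarCompletion P) = r • coe a :=
  map_smul coe r a

instance : StarModule ℂ (CStarCompletion P) where
  star_smul r a := by
    induction a using induction with
    | hp =>
      have h1 : ∀ r : ℂ, Continuous fun x : CStarCompletion P => r • x := continuous_const_smul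
      exact isClosed_eq (continuous_star.comp (h1 r)) ((h1 (star r)).comp continuous_star)
    | h a => rw [← coe_smul, star_coe, star_coe, star_smul, coe_smul]

instance : CStarRing (CStarCompletion P) where
  norm_mul_self_le a := by
    induction a using induction with
    | hp => exact isClosed_le (by fun_prop) (by fun_prop)
    | h a => rw [star_coe, ← map_mul, norm_coe, norm_coe, universalNorm_star_mul_self]

instance : CStarAlgebra (CStarCompletion P) where

variable (P) in
/-- The canonical `*`-homomorphism of `P` to its `C*`-completion. -/
def of : P →⋆ₐ[ℂ] CStarCompletion P where
  __ := coe
  map_star' a := (star_coe a).symm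

/-- A `*`-homomorphism extended by continuity to the `C*`-completions. -/
def mapFun {Q : Type u} [Ring Q] [StarRing Q] [Algebra ℂ Q] [StarModule ℂ Q] [IsCStarBounded Q]
    (f : P →⋆ₐ[ℂ] Q) : CStarCompletion P → CStarCompletion Q :=
  Completion.map (α := PreCStar P) (β := PreCStar Q) f

section

variable {Q : Type u} [Ring Q] [StarRing Q] [Algebra ℂ Q] [StarModule ℂ Q] [IsCStarBounded Q]
  (f : P →⋆ₐ[ℂ] Q)

theorem universalNorm_map_le (a : P) : universalNorm (f a) ≤ universalNorm a :=
  ciSup_le fun ρ => BoundedRep.norm_le (P := P) ⟨ρ.H, ρ.π.comp f⟩ a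

theorem continuous_mapFun : Continuous (mapFun f) := Completion.continuous_map

theorem mapFun_coe (a : P) : mapFun f (coe a) = coe (f a) := by
  let g : PreCStar P →+ PreCStar Q := (f : P →+* Q).toAddMonoidHom
  have hg : LipschitzWith 1 g := AddMonoidHomClass.lipschitz_of_bound_nnnorm g 1 fun a => by
    rw [one_mul]
    exact universalNorm_map_le f a
  exact Completion.map_coe hg.uniformContinuous a

/-- The continuous extension of a `*`-homomorphism `f : P → Q` to a `*`-homomorphism between the
`C*`-completions. -/
def map : CStarCompletion P →⋆ₐ[ℂ] CStarCompletion Q where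
  toFun := mapFun f
  map_one' := by rw [← map_one coe, mapFun_coe, map_one, map_one]
  map_zero' := by rw [← map_zero coe, mapFun_coe, map_zero, map_zero]
  map_mul' a b := by
    have := continuous_mapFun f
    refine denseRange_coe.induction_on₂
      (p := fun a b => mapFun f (a * b) = mapFun f a * mapFun f b) ?_ ?_ a b
    · exact isClosed_eq (by fun_prop) (by fun_prop)
    · intro a b
      rw [← map_mul, mapFun_coe, mapFun_coe, mapFun_coe, map_mul, map_mul]
  map_add' a b := by
    have := continuous_mapFun f
    refine denseRange_coe.induction_on₂
      (p := fun a b => mapFun f (a + b) = mapFun f a + mapFun f b) ?_ ?_ a b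
    · exact isClosed_eq (by fun_prop) (by fun_prop)
    · intro a b
      rw [← map_add, mapFun_coe, mapFun_coe, mapFun_coe, map_add, map_add]
  commutes' r := by
    rw [← AlgHom.commutes coe, mapFun_coe, AlgHomClass.commutes f, AlgHom.commutes]
  map_star' a := by
    have := continuous_mapFun f
    induction a using induction with
    | hp => exact isClosed_eq (by fun_prop) (by fun_prop)
    | h a => rw [star_coe, mapFun_coe, mapFun_coe, map_star, star_coe]

theorem continuous_map : Continuous (map f) := continuous_mapFun f

@[simp] theorem map_of (a : P) : map f (of P a) = of Q (f a) := mapFun_coe f a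

end

end CStarCompletion

end Completion

/-! ### The equator quantum sphere -/

/-- The names of the generators of the quantum sphere. -/
inductive SphereGen : Type
  | A
  | B

/-- The defining relations of the equator quantum sphere
`A* = A`, `B A = q² A B`, `B* B = -A² + 1`, `B B* = -q⁴ A² + 1`,
together with their adjoints. -/
inductive SphereRel (q : ℝ) : FreeStarAlg SphereGen → FreeStarAlg SphereGen → Prop
  | selfAdjoint : SphereRel q (star (FreeStarAlg.gen .A)) (FreeStarAlg.gen .A)
  | comm : SphereRel q (FreeStarAlg.gen .B * FreeStarAlg.gen .A)
      (((q : ℂ) ^ 2) • (FreeStarAlg.gen .A * FreeStarAlg.gen .B))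
  | star_mul_self : SphereRel q (star (FreeStarAlg.gen .B) * FreeStarAlg.gen .B)
      (-FreeStarAlg.gen .A ^ 2 + 1)
  | mul_star_self : SphereRel q (FreeStarAlg.gen .B * star (FreeStarAlg.gen .B))
      (-(((q : ℂ) ^ 4) • FreeStarAlg.gen .A ^ 2) + 1)
  | adjoint {a b : FreeStarAlg SphereGen} : SphereRel q a b → SphereRel q (star a) (star b)

/-- The polynomial `*`-algebra of the equator quantum sphere: the quotient of the free
`*`-algebra on `A`, `B` by the two-sided `*`-ideal generated by the relations. -/
def PolySphere (q : ℝ) : Type := RingQuot (SphereRel q)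

namespace PolySphere

variable {q : ℝ}

instance : Ring (PolySphere q) := inferInstanceAs (Ring (RingQuot (SphereRel q)))

instance : Algebra ℂ (PolySphere q) := inferInstanceAs (Algebra ℂ (RingQuot (SphereRel q)))

instance : StarRing (PolySphere q) :=
  RingQuot.starRing (SphereRel q) fun _ _ h => SphereRel.adjoint h

/-- The quotient map. -/
def mk : FreeStarAlg SphereGen →ₐ[ℂ] PolySphere q := RingQuot.mkAlgHom ℂ (SphereRel q)

theorem mk_surjective : Function.Surjective (mk (q := q)) :=
  RingQuot.mkAlgHom_surjective ℂ (SphereRel q)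

theorem mk_rel {a b : FreeStarAlg SphereGen} (h : SphereRel q a b) : mk (q := q) a = mk b :=
  RingQuot.mkAlgHom_rel ℂ h

theorem star_mk (a : FreeStarAlg SphereGen) : star (mk a : PolySphere q) = mk (star a) := by
  have h : ∀ b, mk (q := q) b = RingQuot.mkRingHom (SphereRel q) b := fun b =>
    DFunLike.congr_fun (RingQuot.mkAlgHom_coe ℂ (SphereRel q)) b
  rw [h, h]
  simp only [RingQuot.mkRingHom_def]
  rfl

instance : StarModule ℂ (PolySphere q) where
  star_smul r a := by
    obtain ⟨a, rfl⟩ := mk_surjective a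
    rw [← map_smul, star_mk, star_mk, star_smul, map_smul]

/-- The generator `A`. -/
def A : PolySphere q := mk (FreeStarAlg.gen .A)

/-- The generator `B`. -/
def B : PolySphere q := mk (FreeStarAlg.gen .B)

theorem star_A : star (A : PolySphere q) = A :=
  (star_mk _).trans (mk_rel .selfAdjoint)

theorem B_mul_A : (B * A : PolySphere q) = ((q : ℂ) ^ 2) • (A * B) := by
  have h := mk_rel (q := q) .comm
  rwa [map_mul, map_smul, map_mul] at h

theorem star_B_mul_B : (star B * B : PolySphere q) = -A ^ 2 + 1 := by
  have h := mk_rel (q := q) .star_mul_self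
  rwa [map_mul, map_add, map_neg, map_pow, map_one, ← star_mk] at h

theorem B_mul_star_B : (B * star B : PolySphere q) = -(((q : ℂ) ^ 4) • A ^ 2) + 1 := by
  have h := mk_rel (q := q) .mul_star_self
  rwa [map_mul, map_add, map_neg, map_smul, map_pow, map_one, ← star_mk] at h

/-- In a bounded representation, both operators `a`, `b` with `a* a + b* b = 1` are contractions. -/
theorem norm_le_one_of_star_mul_self_add {H : Type u} [NormedAddCommGroup H]
    [InnerProductSpace ℂ H] [CompleteSpace H] {a b : H →L[ℂ] H} (h : star a * a + star b * b = 1) :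
    ‖a‖ ≤ 1 := by
  refine ContinuousLinearMap.opNorm_le_bound _ zero_le_one fun x => ?_
  have h1 := ContinuousLinearMap.apply_norm_sq_eq_inner_adjoint_left a x
  have h2 := ContinuousLinearMap.apply_norm_sq_eq_inner_adjoint_left b x
  have h3 : ‖a x‖ ^ 2 + ‖b x‖ ^ 2 = ‖x‖ ^ 2 := by
    rw [h1, h2, ← map_add, ← inner_add_left]
    have h4 := DFunLike.congr_fun h x
    rw [add_apply] at h4
    refine (congrArg (fun y => RCLike.re (inner ℂ y x)) h4).trans ?_
    exact inner_self_eq_norm_sq (𝕜 := ℂ) x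
  rw [one_mul]
  exact (sq_le_sq₀ (norm_nonneg _) (norm_nonneg _)).1 (by nlinarith [sq_nonneg ‖b x‖])

theorem norm_letter_le (ρ : BoundedRep (PolySphere q)) (y : SphereGen ⊕ SphereGen) :
    ‖ρ.π (mk (FreeStarAlg.letter y))‖ ≤ 1 := by
  have h : star (ρ.π A) * ρ.π A + star (ρ.π B) * ρ.π B = 1 := by
    rw [← map_star, ← map_star, ← map_mul, ← map_mul, ← map_add, star_A, star_B_mul_B, sq,
      add_neg_cancel_left, map_one]
  have hA := norm_le_one_of_star_mul_self_add h
  have hB := norm_le_one_of_star_mul_self_add ((add_comm _ _).trans h)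
  have hstar : ∀ x, ‖ρ.π (mk (FreeStarAlg.letter (.inr x)))‖
      = ‖ρ.π (mk (FreeStarAlg.letter (.inl x)))‖ := fun x => by
    rw [← norm_star, ← map_star, star_mk, FreeStarAlg.star_letter]
    rfl
  rcases y with (_ | _) | (_ | _)
  · exact hA
  · exact hB
  · exact (hstar _).trans_le hA
  · exact (hstar _).trans_le hB

instance : IsCStarBounded (PolySphere q) where
  bdd a := by
    obtain ⟨a, rfl⟩ := mk_surjective a
    suffices ∃ C : ℝ, ∀ ρ : BoundedRep (PolySphere q), ‖ρ.π (mk a)‖ ≤ C by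
      obtain ⟨C, hC⟩ := this
      exact ⟨C, by rintro _ ⟨ρ, rfl⟩; exact hC ρ⟩
    induction a using FreeStarAlg.induction with
    | h0 r =>
      refine ⟨‖r‖, fun ρ => ?_⟩
      rw [AlgHom.commutes, AlgHomClass.commutes, Algebra.algebraMap_eq_smul_one]
      refine (norm_smul_le _ _).trans (mul_le_of_le_one_right (norm_nonneg r) ?_)
      exact ContinuousLinearMap.norm_id_le
    | h1 y => exact ⟨1, fun ρ => norm_letter_le ρ y⟩
    | h2 a b ha hb =>
      obtain ⟨C, hC⟩ := ha
      obtain ⟨D, hD⟩ := hb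
      refine ⟨C * D, fun ρ => ?_⟩
      rw [map_mul, map_mul]
      exact (norm_mul_le _ _).trans
        (mul_le_mul (hC ρ) (hD ρ) (norm_nonneg _) ((norm_nonneg _).trans (hC ρ)))
    | h3 a b ha hb =>
      obtain ⟨C, hC⟩ := ha
      obtain ⟨D, hD⟩ := hb
      refine ⟨C + D, fun ρ => ?_⟩
      rw [map_add, map_add]
      exact (norm_add_le _ _).trans (add_le_add (hC ρ) (hD ρ))

/-- The antipodal map on the free `*`-algebra, with values in the polynomial algebra. -/
def freeAntipode (q : ℝ) : FreeStarAlg SphereGen →ₐ[ℂ] PolySphere q :=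
  FreeStarAlg.lift fun y => -mk (FreeStarAlg.letter y)

theorem freeAntipode_gen (x : SphereGen) :
    freeAntipode q (FreeStarAlg.gen x) = -mk (FreeStarAlg.gen x) :=
  FreeStarAlg.lift_letter _ _

theorem freeAntipode_star (a : FreeStarAlg SphereGen) :
    freeAntipode q (star a) = star (freeAntipode q a) := by
  induction a using FreeStarAlg.induction with
  | h0 r =>
    rw [AlgHom.commutes, ← algebraMap_star_comm, ← algebraMap_star_comm, AlgHom.commutes]
  | h1 y =>
    simp only [freeAntipode, FreeStarAlg.star_letter, FreeStarAlg.lift_letter, star_neg, star_mk]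
  | h2 a b ha hb => rw [star_mul, map_mul, map_mul, star_mul, ha, hb]
  | h3 a b ha hb => rw [star_add, map_add, map_add, star_add, ha, hb]

theorem freeAntipode_rel {a b : FreeStarAlg SphereGen} (h : SphereRel q a b) :
    freeAntipode q a = freeAntipode q b := by
  induction h with
  | selfAdjoint =>
    rw [freeAntipode_star, freeAntipode_gen, star_neg]
    exact congrArg Neg.neg star_A
  | comm =>
    rw [map_mul, map_smul, map_mul, freeAntipode_gen, freeAntipode_gen, neg_mul_neg, neg_mul_neg]
    exact B_mul_A
  | star_mul_self =>
    rw [map_mul, map_add, map_neg, map_pow, map_one, freeAntipode_star, freeAntipode_gen,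
      freeAntipode_gen, star_neg, neg_mul_neg, neg_sq]
    exact star_B_mul_B
  | mul_star_self =>
    rw [map_mul, map_add, map_neg, map_smul, map_pow, map_one, freeAntipode_star,
      freeAntipode_gen, freeAntipode_gen, star_neg, neg_mul_neg, neg_sq]
    exact B_mul_star_B
  | adjoint _ ih => rw [freeAntipode_star, freeAntipode_star, ih]

/-- The antipodal `*`-automorphism `A ↦ -A`, `B ↦ -B` of the polynomial algebra. -/
def antipode (q : ℝ) : PolySphere q →⋆ₐ[ℂ] PolySphere q where
  __ : PolySphere q →ₐ[ℂ] PolySphere q :=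
    RingQuot.liftAlgHom ℂ ⟨freeAntipode q, fun _ _ h => freeAntipode_rel h⟩
  map_star' a := by
    obtain ⟨a, rfl⟩ := mk_surjective a
    have h : ∀ b, (RingQuot.liftAlgHom ℂ ⟨freeAntipode q, fun _ _ h => freeAntipode_rel h⟩ :
        PolySphere q →ₐ[ℂ] PolySphere q) (mk b) = freeAntipode q b :=
      RingQuot.liftAlgHom_mkAlgHom_apply ℂ (freeAntipode q) (fun _ _ h => freeAntipode_rel h)
    rw [star_mk]
    exact (h _).trans ((freeAntipode_star a).trans (congrArg star (h a).symm))

theorem antipode_mk (a : FreeStarAlg SphereGen) : antipode q (mk a) = freeAntipode q a :=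
  RingQuot.liftAlgHom_mkAlgHom_apply ℂ (freeAntipode q) (fun _ _ h => freeAntipode_rel h) a

@[simp] theorem antipode_A : antipode q A = -A := (antipode_mk _).trans (freeAntipode_gen _)

@[simp] theorem antipode_B : antipode q B = -B := (antipode_mk _).trans (freeAntipode_gen _)

end PolySphere

/-- The `C*`-algebra of the equator quantum sphere. -/
abbrev CSphere (q : ℝ) : Type := CStarCompletion (PolySphere q)

/-- The antipodal `*`-automorphism of the `C*`-algebra of the equator quantum sphere: the
continuous extension of `A ↦ -A`, `B ↦ -B`. -/
def cAntipode (q : ℝ) : CSphere q →⋆ₐ[ℂ] CSphere q :=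
  CStarCompletion.map (PolySphere.antipode q)

/-! ### The quantum real projective plane -/

/-- The polynomial `*`-algebra of the quantum real projective plane: the fixed points of the
antipodal map in the polynomial algebra of the quantum sphere. -/
def PolyRP (q : ℝ) : StarSubalgebra ℂ (PolySphere q) :=
  StarAlgHom.equalizer (PolySphere.antipode q) (StarAlgHom.id ℂ (PolySphere q))

/-- The `C*`-algebra of the quantum real projective plane: the fixed points of the antipodal map
in the `C*`-algebra of the quantum sphere, with the norm of the latter. -/
def CRP (q : ℝ) : StarSubalgebra ℂ (CSphere q) :=
  StarAlgHom.equalizer (cAntipode q) (StarAlgHom.id ℂ (CSphere q))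

instance (q : ℝ) : IsClosed (CRP q : Set (CSphere q)) :=
  isClosed_eq (CStarCompletion.continuous_map (PolySphere.antipode q)) continuous_id

/-- The canonical `*`-homomorphism of the polynomial algebra of the quantum real projective plane
to its `C*`-algebra: the restriction of the canonical map for the quantum sphere. -/
def rpIncl (q : ℝ) : PolyRP q →⋆ₐ[ℂ] CRP q :=
  StarAlgHom.codRestrict ((CStarCompletion.of (PolySphere q)).comp (PolyRP q).subtype) (CRP q)
    fun a => (CStarCompletion.map_of (PolySphere.antipode q) a).trans
      (congrArg (CStarCompletion.of (PolySphere q)) a.2)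

theorem coe_rpIncl {q : ℝ} (a : PolyRP q) :
    (rpIncl q a : CSphere q) = CStarCompletion.of (PolySphere q) a := rfl

end

/-! The heart is that every unital `*`-homomorphism `φ` from the even polynomials to a `C*`-algebra
is bounded by the norm of the sphere. Let `E(a) = (a + r₂(a))/2` be the projection onto the even
part. Choose a state `g` with `g(φ(a)*φ(a)) = ‖φ(a)‖²` and pull it back to the functional `f = g ∘ φ
∘ E` on the whole sphere algebra.

Positivity of `f` is the crucial point. Write `a = a₀ + a₁` with `a₀` even and `a₁` odd; then
`E(a*a) = a₀*a₀ + a₁*a₁`. The second term is not visibly a sum of squares of even elements, but the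
sphere relation `A*A + B*B = 1` turns it into `(A a₁)*(A a₁) + (B a₁)*(B a₁)`, where `A a₁` and `B
a₁` are even (`even_star_mul_self`).

The same relation, together with the one for `B B*`, makes left multiplications bounded for `f`, so
the GNS construction represents the sphere algebra and gives `f(a*a) ≤ ‖a‖² f(1)`. For even `a` this
reads `‖φ(a)‖ ≤ ‖a‖` (`norm_map_le_universalNorm`). Conversely, representations of the sphere
restrict to the even part, so the two norms agree. Density follows from continuity of `E`, and the
universal property by continuous extension. -/

/-! ### States on a `C*`-algebra -/

section State

open scoped ComplexOrder

variable {D : Type v} [CStarAlgebra D]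

/-- A functional of norm at most one which is one at the unit is real on self-adjoint elements. -/
theorem im_eq_zero_of_isSelfAdjoint {g : D →L[ℂ] ℂ} (hg : ‖g‖ ≤ 1) (h1 : g 1 = 1) {c : D}
    (hc : IsSelfAdjoint c) : (g c).im = 0 := by
  have hone : ‖(1 : D)‖ ≤ 1 := by
    nontriviality D
    exact CStarRing.norm_one.le
  -- Evaluate `g` at `c + it`, whose norm squared is at most `‖c‖² + t²` because `c` is
  -- self-adjoint.
  have key : ∀ t : ℝ, ((g c).im + t) ^ 2 ≤ ‖c‖ ^ 2 + t ^ 2 := fun t => by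
    have e1 : star (c + (Complex.I * t) • (1 : D)) * (c + (Complex.I * t) • (1 : D))
        = c * c + ((t : ℂ) ^ 2) • (1 : D) := by
      rw [star_add, star_smul, star_one, hc.star_eq]
      simp only [star_mul', Complex.star_def, Complex.conj_I, Complex.conj_ofReal, mul_add,
        add_mul, smul_mul_assoc, mul_smul_comm, one_mul, mul_one, smul_add, smul_smul]
      have : (-Complex.I * t * (Complex.I * t) : ℂ) = (t : ℂ) ^ 2 := by
        linear_combination (-(t : ℂ) ^ 2) * Complex.I_sq
      rw [mul_comm (Complex.I * (t : ℂ)) (-Complex.I * t), this]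
      module
    have e2 : ‖c + (Complex.I * t) • (1 : D)‖ ^ 2 ≤ ‖c‖ ^ 2 + t ^ 2 := by
      rw [sq, ← CStarRing.norm_star_mul_self, e1]
      refine (norm_add_le _ _).trans (add_le_add ?_ ?_)
      · rw [sq]; exact norm_mul_le _ _
      · rw [norm_smul, norm_pow, Complex.norm_real, Real.norm_eq_abs, sq_abs]
        exact mul_le_of_le_one_right (sq_nonneg t) hone
    refine le_trans ?_ e2
    have e3 : (g (c + (Complex.I * t) • (1 : D))).im = (g c).im + t := by
      rw [map_add, map_smul, h1]; simp
    rw [← e3, ← sq_abs]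
    refine pow_le_pow_left₀ (abs_nonneg _) ((Complex.abs_im_le_norm _).trans ?_) 2
    exact (g.le_opNorm _).trans (mul_le_of_le_one_left (norm_nonneg _) hg)
  by_contra hne
  -- The bound is linear in `t` once `t²` cancels; this `t` makes the cross term `‖c‖² + 1`, too
  -- large.
  have h := key ((‖c‖ ^ 2 + 1) / (2 * (g c).im))
  have h2 : 2 * (g c).im * ((‖c‖ ^ 2 + 1) / (2 * (g c).im)) = ‖c‖ ^ 2 + 1 := by
    field_simp
  nlinarith [sq_nonneg (g c).im]

/-- A functional of norm at most one which is one at the unit is positive. -/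
theorem apply_star_mul_self_nonneg {g : D →L[ℂ] ℂ} (hg : ‖g‖ ≤ 1) (h1 : g 1 = 1) (d : D) :
    0 ≤ g (star d * d) := by
  let := CStarAlgebra.spectralOrder D
  let := CStarAlgebra.spectralOrderedRing D
  set c := star d * d with hc
  have hc0 : 0 ≤ c := star_mul_self_nonneg d
  have him := im_eq_zero_of_isSelfAdjoint hg h1 (IsSelfAdjoint.of_nonneg hc0)
  refine Complex.nonneg_iff.2 ⟨?_, him.symm⟩
  -- Since `0 ≤ c ≤ ‖c‖`; applying `g` then yields `‖c‖ - Re g(c) ≤ ‖c‖`.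
  have h2 : ‖algebraMap ℝ D ‖c‖ - c‖ ≤ ‖c‖ := by
    have h3 : c ≤ algebraMap ℝ D ‖c‖ := IsSelfAdjoint.le_algebraMap_norm_self (.of_nonneg hc0)
    rw [CStarAlgebra.norm_le_iff_le_algebraMap _ (norm_nonneg c) (sub_nonneg.2 h3)]
    exact sub_le_self _ hc0
  have h4 : (g (algebraMap ℝ D ‖c‖ - c)).re = ‖c‖ - (g c).re := by
    have : algebraMap ℝ D ‖c‖ = (‖c‖ : ℂ) • (1 : D) := by
      rw [Algebra.algebraMap_eq_smul_one, Complex.coe_smul]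
    rw [map_sub, this, map_smul, h1]; simp
  have h5 := (Complex.re_le_norm _).trans ((g.le_opNorm _).trans
    ((mul_le_of_le_one_left (norm_nonneg _) hg).trans h2))
  rw [h4] at h5
  linarith

/-- Every element `d* d` of a `C*`-algebra attains its norm at a state. -/
theorem exists_state_apply_eq_norm [Nontrivial D] (d : D) :
    ∃ g : D →L[ℂ] ℂ, ‖g‖ ≤ 1 ∧ g 1 = 1 ∧ g (star d * d) = (‖star d * d‖ : ℂ) := by
  let := CStarAlgebra.spectralOrder D
  let := CStarAlgebra.spectralOrderedRing D
  have hb : 0 ≤ star d * d := star_mul_self_nonneg d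
  generalize star d * d = b at hb ⊢
  by_cases hb0 : b = 0
  · obtain ⟨g, hg, h1⟩ := exists_dual_vector ℂ (1 : D) (norm_ne_zero_iff.2 one_ne_zero)
    exact ⟨g, hg.le, by simpa using h1, by simp [hb0]⟩
  have hpos : 0 < ‖b‖ := norm_pos_iff.2 hb0
  -- A functional norming `‖b‖ + b`, whose norm is `2‖b‖`, has to norm both `1` and `b`, so it is a
  -- state attaining `‖b‖`.
  set x : D := algebraMap ℝ D ‖b‖ + b with hx
  have hmem : ‖b‖ + ‖b‖ ∈ spectrum ℝ x :=
    spectrum.add_mem_add_iff.2 (CStarAlgebra.norm_mem_spectrum_of_nonneg hb)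
  have hnx : ‖b‖ + ‖b‖ ≤ ‖x‖ := by
    have := spectrum.norm_le_norm_of_mem hmem
    rwa [Real.norm_of_nonneg (by positivity)] at this
  obtain ⟨g, hg, hgx⟩ := exists_dual_vector ℂ x (by linarith)
  have hxc : x = (‖b‖ : ℂ) • (1 : D) + b := by
    rw [hx, Algebra.algebraMap_eq_smul_one, Complex.coe_smul]
  have hle : ∀ y, ‖g y‖ ≤ ‖y‖ := fun y => by simpa [hg] using g.le_opNorm y
  have h1 : ‖g 1‖ ≤ 1 := (hle 1).trans_eq CStarRing.norm_one
  have hre : ‖b‖ * (g 1).re + (g b).re = ‖x‖ := by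
    have := congrArg Complex.re hgx
    rw [hxc, map_add, map_smul] at this
    simpa [hxc] using this
  have r1 := (Complex.re_le_norm (g 1)).trans h1
  have rb := (Complex.re_le_norm (g b)).trans (hle b)
  -- Both upper bounds `r1` and `rb` must be equalities, as their weighted sum is at least `2‖b‖`.
  have e1 : (g 1).re = 1 := by nlinarith
  have eb : (g b).re = ‖b‖ := by nlinarith
  have real_of : ∀ (z : ℂ) (r : ℝ), 0 ≤ r → z.re = r → ‖z‖ ≤ r → z = r := fun z r hr hz hn => by
    have h := Complex.sq_norm z
    rw [Complex.normSq_apply, hz] at h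
    have : z.im = 0 := by
      have : z.im * z.im ≤ 0 := by nlinarith [norm_nonneg z]
      nlinarith [mul_self_eq_zero.1 (le_antisymm this (mul_self_nonneg _))]
    exact Complex.ext hz this
  exact ⟨g, hg.le, by simpa using real_of _ 1 zero_le_one e1 h1,
    real_of _ _ (norm_nonneg b) eb (hle b)⟩

/-- A functional of norm at most one which is one at the unit is hermitian. -/
theorem apply_star_of_state {g : D →L[ℂ] ℂ} (hg : ‖g‖ ≤ 1) (h1 : g 1 = 1) (d : D) :
    g (star d) = star (g d) := by
  have hre := im_eq_zero_of_isSelfAdjoint hg h1 (realPart d).2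
  have him := im_eq_zero_of_isSelfAdjoint hg h1 (imaginaryPart d).2
  have hs : star d = (realPart d : D) - Complex.I • (imaginaryPart d : D) := by
    conv_lhs => rw [← realPart_add_I_smul_imaginaryPart d]
    rw [star_add, star_smul, (realPart d).2.star_eq, (imaginaryPart d).2.star_eq]
    simp [sub_eq_add_neg]
  rw [hs]
  conv_rhs => rw [← realPart_add_I_smul_imaginaryPart d]
  apply Complex.ext <;> simp [hre, him]

end State

/-! ### GNS representation of a positive functional on a `*`-algebra -/

noncomputable section

section GNS

open scoped ComplexOrder InnerProductSpace

variable (P : Type u) [Ring P] [StarRing P] [Algebra ℂ P] [StarModule ℂ P]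

/-- A positive functional on a `*`-algebra for which left multiplications are bounded. -/
structure BoundedPositiveFunctional extends P →ₗ[ℂ] ℂ where
  /-- The functional is positive. -/
  nonneg' (a : P) : 0 ≤ toFun (star a * a)
  /-- The functional is hermitian. -/
  map_star' (a : P) : toFun (star a) = star (toFun a)
  /-- Left multiplications are bounded. -/
  bounded' (a : P) : ∃ C : ℝ, ∀ x, (toFun (star (a * x) * (a * x))).re ≤ C * (toFun (star x * x)).re

namespace BoundedPositiveFunctional

variable {P} (f : BoundedPositiveFunctional P)

set_option linter.unusedVariables false in
/-- The `*`-algebra with the semi-inner product given by `f`. -/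
@[nolint unusedArguments]
def PreGNS (f : BoundedPositiveFunctional P) : Type u := P

instance : AddCommGroup f.PreGNS := inferInstanceAs (AddCommGroup P)
instance : Module ℂ f.PreGNS := inferInstanceAs (Module ℂ P)

/-- The identity map to the pre-Hilbert space. -/
def toPreGNS : P ≃ₗ[ℂ] f.PreGNS := LinearEquiv.refl ℂ _

/-- The identity map from the pre-Hilbert space. -/
def ofPreGNS : f.PreGNS ≃ₗ[ℂ] P := f.toPreGNS.symm

omit [StarModule ℂ P] in
@[simp] theorem ofPreGNS_toPreGNS (a : P) : f.ofPreGNS (f.toPreGNS a) = a := rfl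

omit [StarModule ℂ P] in
@[simp] theorem toPreGNS_ofPreGNS (a : f.PreGNS) : f.toPreGNS (f.ofPreGNS a) = a := rfl

/-- The semi-inner product `⟨a, b⟩ = f (a* b)`. -/
abbrev core : PreInnerProductSpace.Core ℂ f.PreGNS where
  inner a b := f.toLinearMap (star (f.ofPreGNS a) * f.ofPreGNS b)
  conj_inner_symm a b := by
    have h := f.map_star' (star (f.ofPreGNS b) * f.ofPreGNS a)
    rw [star_mul, star_star] at h
    exact h.symm
  re_inner_nonneg a := (Complex.nonneg_iff.1 (f.nonneg' (f.ofPreGNS a))).1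
  add_left a b c := by rw [map_add, star_add, add_mul, map_add]
  smul_left a b r := by
    rw [map_smul, star_smul, smul_mul_assoc, map_smul]
    rfl

/-- Null vectors are kept at this stage; the Hausdorff completion identifies them with zero. -/
instance : SeminormedAddCommGroup f.PreGNS :=
  InnerProductSpace.Core.toSeminormedAddCommGroup (c := f.core)
instance : InnerProductSpace ℂ f.PreGNS := InnerProductSpace.ofCore f.core

theorem inner_def (a b : f.PreGNS) :
    ⟪a, b⟫_ℂ = f.toLinearMap (star (f.ofPreGNS a) * f.ofPreGNS b) := rfl

theorem norm_sq (a : f.PreGNS) :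
    ‖a‖ ^ 2 = (f.toLinearMap (star (f.ofPreGNS a) * f.ofPreGNS a)).re :=
  (inner_self_eq_norm_sq (𝕜 := ℂ) a).symm

/-- Left multiplication on the pre-Hilbert space. -/
def leftMul (a : P) : f.PreGNS →L[ℂ] f.PreGNS :=
  LinearMap.mkContinuousOfExistsBound
    (f.toPreGNS.toLinearMap ∘ₗ LinearMap.mulLeft ℂ a ∘ₗ f.ofPreGNS.toLinearMap) (by
    obtain ⟨C, hC⟩ := f.bounded' a
    -- The constant `C` is not assumed nonnegative, hence the maximum under the root.
    refine ⟨√(max C 0), fun x => ?_⟩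
    rw [← sq_le_sq₀ (norm_nonneg _) (by positivity), mul_pow, Real.sq_sqrt (le_max_right _ _),
      norm_sq, norm_sq]
    refine (hC (f.ofPreGNS x)).trans (mul_le_mul_of_nonneg_right (le_max_left _ _) ?_)
    exact (Complex.nonneg_iff.1 (f.nonneg' _)).1)

theorem leftMul_apply (a : P) (x : f.PreGNS) :
    f.leftMul a x = f.toPreGNS (a * f.ofPreGNS x) := rfl

/-- The Hilbert space of the GNS representation. -/
abbrev GNS : Type u := UniformSpace.Completion f.PreGNS

theorem leftMul_one : f.leftMul 1 = .id ℂ _ := by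
  ext x
  simp [leftMul_apply]

theorem leftMul_mul (a b : P) : f.leftMul (a * b) = f.leftMul a ∘L f.leftMul b := by
  ext x
  simp [leftMul_apply, mul_assoc]

theorem leftMul_add (a b : P) : f.leftMul (a + b) = f.leftMul a + f.leftMul b := by
  ext x
  simp [leftMul_apply, add_mul]

theorem leftMul_smul (r : ℂ) (a : P) : f.leftMul (r • a) = r • f.leftMul a := by
  ext x
  simp [leftMul_apply]

theorem inner_leftMul (a : P) (x y : f.PreGNS) :
    ⟪f.leftMul (star a) x, y⟫_ℂ = ⟪x, f.leftMul a y⟫_ℂ := by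
  simp [inner_def, leftMul_apply, mul_assoc]

theorem ext_completion {S T : f.GNS →L[ℂ] f.GNS} (h : ∀ x : f.PreGNS, S x = T x) : S = T := by
  ext c
  induction c using UniformSpace.Completion.induction_on with
  | hp => exact isClosed_eq S.continuous T.continuous
  | ih c => exact h c

/-- The GNS representation. -/
def gnsHom : P →⋆ₐ[ℂ] (f.GNS →L[ℂ] f.GNS) where
  toFun a := (f.leftMul a).completion
  map_one' := f.ext_completion fun x => by simp [leftMul_one]
  map_mul' a b := f.ext_completion fun x => by simp [leftMul_mul]
  map_zero' := f.ext_completion fun x => by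
    have h : f.leftMul 0 x = 0 := by rw [leftMul_apply, zero_mul, map_zero]
    rw [ContinuousLinearMap.completion_apply_coe, h]
    exact UniformSpace.Completion.coe_zero
  map_add' a b := f.ext_completion fun x => by
    simp [leftMul_add, UniformSpace.Completion.coe_add]
  commutes' r := f.ext_completion fun x => by
    simp [Algebra.algebraMap_eq_smul_one, leftMul_smul, leftMul_one]
  map_star' a := by
    refine (ContinuousLinearMap.eq_adjoint_iff _ _).mpr fun x y => ?_
    induction x, y using UniformSpace.Completion.induction_on₂ with
    | hp => apply isClosed_eq <;> fun_prop
    | ih x y => simp [inner_leftMul]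

theorem gnsHom_apply_coe (a : P) (x : f.PreGNS) :
    f.gnsHom a (x : f.GNS) = (f.leftMul a x : f.PreGNS) :=
  ContinuousLinearMap.completion_apply_coe _ _

/-- The GNS representation as a bounded representation. -/
def gnsRep : BoundedRep P where
  H := f.GNS
  π := f.gnsHom

/-- The state inequality `f (a* a) ≤ ‖a‖² f(1)` for the universal norm. -/
theorem apply_star_mul_self_le [IsCStarBounded P] (a : P) :
    (f.toLinearMap (star a * a)).re ≤ universalNorm a ^ 2 * (f.toLinearMap 1).re := by
  -- The class of `1` is the cyclic vector: `‖π(a)e‖² = f(a*a)` and `‖e‖² = f(1)`.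
  let e : f.PreGNS := f.toPreGNS 1
  have h1 : ‖(f.leftMul a e : f.GNS)‖ ≤ universalNorm a * ‖(e : f.GNS)‖ := by
    rw [← gnsHom_apply_coe]
    exact (ContinuousLinearMap.le_opNorm _ _).trans
      (mul_le_mul_of_nonneg_right (f.gnsRep.norm_le a) (norm_nonneg _))
  rw [UniformSpace.Completion.norm_coe, UniformSpace.Completion.norm_coe] at h1
  have h2 := pow_le_pow_left₀ (norm_nonneg _) h1 2
  rw [mul_pow, norm_sq, norm_sq, leftMul_apply] at h2
  simpa [e] using h2

end BoundedPositiveFunctional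

end GNS

end

/-! ### Even and odd parts of the sphere algebra -/

noncomputable section

open scoped ComplexOrder

namespace PolySphere

variable {q : ℝ}

theorem antipode_antipode (a : PolySphere q) : antipode q (antipode q a) = a := by
  obtain ⟨a, rfl⟩ := mk_surjective a
  induction a using FreeStarAlg.induction with
  | h0 r => rw [AlgHom.commutes, AlgHomClass.commutes, AlgHomClass.commutes]
  | h1 y =>
    have h : antipode q (mk (FreeStarAlg.letter y)) = -mk (FreeStarAlg.letter y) :=
      (antipode_mk _).trans (FreeStarAlg.lift_letter _ _)
    rw [h, map_neg, h, neg_neg]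
  | h2 a b ha hb => simp only [map_mul, ha, hb]
  | h3 a b ha hb => simp only [map_add, ha, hb]

theorem mem_polyRP {a : PolySphere q} : a ∈ PolyRP q ↔ antipode q a = a := Iff.rfl

/-- The projection of the polynomial algebra of the quantum sphere onto the even elements. -/
def even (q : ℝ) : PolySphere q →ₗ[ℂ] PolyRP q :=
  LinearMap.codRestrict (PolyRP q).toSubalgebra.toSubmodule
    ((2⁻¹ : ℂ) • (LinearMap.id + (antipode q : PolySphere q →ₗ[ℂ] PolySphere q)))
    fun a => by
      change antipode q ((2⁻¹ : ℂ) • (a + antipode q a)) = (2⁻¹ : ℂ) • (a + antipode q a)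
      rw [map_smul, map_add, antipode_antipode, add_comm]

theorem coe_even (a : PolySphere q) :
    (even q a : PolySphere q) = (2⁻¹ : ℂ) • (a + antipode q a) := rfl

theorem even_coe (a : PolyRP q) : even q a = a := by
  ext
  rw [coe_even, mem_polyRP.1 a.2]
  module

theorem even_star (a : PolySphere q) : even q (star a) = star (even q a) := by
  ext
  rw [StarMemClass.coe_star, coe_even, coe_even, star_smul, star_add, map_star]
  simp

/-- The odd part of an element. -/
def odd (a : PolySphere q) : PolySphere q := (2⁻¹ : ℂ) • (a - antipode q a)

theorem antipode_odd (a : PolySphere q) : antipode q (odd a) = -odd a := by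
  rw [odd, map_smul, map_sub, antipode_antipode, ← smul_neg, neg_sub]

/-- The product of an odd element and the odd part of an element, as an even element. -/
def mulOdd (y : PolySphere q) (hy : antipode q y = -y) (a : PolySphere q) : PolyRP q :=
  ⟨y * odd a, mem_polyRP.2 (by rw [map_mul, hy, antipode_odd, neg_mul_neg])⟩

/-- Insert `1 = A² + B*B` between the two factors. -/
theorem star_mul_self_eq (a : PolySphere q) : star a * a = star (A * a) * (A * a)
    + star (B * a) * (B * a) := by
  calc star a * a = star a * (A * A + star B * B) * a := by
        rw [star_B_mul_B, sq, add_neg_cancel_left, mul_one]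
    _ = _ := by rw [star_mul, star_mul, star_A]; noncomm_ring

/-- Insert `1 = BB* + q⁴A²` instead; this controls left multiplication by `B*`. -/
theorem star_mul_self_eq' (a : PolySphere q) :
    star a * a = star (star B * a) * (star B * a) + (q ^ 4 : ℂ) • (star (A * a) * (A * a)) := by
  calc star a * a = star a * (B * star B + (q ^ 4 : ℂ) • (A * A)) * a := by
        rw [B_mul_star_B, sq, add_right_comm, neg_add_cancel, zero_add, mul_one]
    _ = _ := by
      rw [star_mul, star_mul, star_A, star_star, mul_add, add_mul, mul_smul_comm, smul_mul_assoc]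
      noncomm_ring

/-- Averaging removes the mixed even-odd terms, and the square of the odd part splits into squares
of even elements. Hence positivity on the even part passes to the whole algebra. -/
theorem even_star_mul_self (a : PolySphere q) :
    even q (star a * a) = star (even q a) * even q a
      + (star (mulOdd A antipode_A a) * mulOdd A antipode_A a
        + star (mulOdd B antipode_B a) * mulOdd B antipode_B a) := by
  ext
  change (2⁻¹ : ℂ) • (star a * a + antipode q (star a * a)) =
    star ((2⁻¹ : ℂ) • (a + antipode q a)) * ((2⁻¹ : ℂ) • (a + antipode q a))
      + (star (A * odd a) * (A * odd a) + star (B * odd a) * (B * odd a))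
  -- The `A` and `B` terms recombine into the square of the odd part, leaving a bilinear identity in
  -- `a` and its antipode.
  rw [← star_mul_self_eq, odd, map_mul, map_star]
  simp only [star_smul, star_add, star_sub, smul_mul_smul_comm, mul_add, add_mul, mul_sub, sub_mul]
  simp only [star_inv₀, star_ofNat]
  module

/-! ### The induced positive functional and the norm estimate -/

variable {D : Type v} [CStarAlgebra D]

/-- Composing a state with a `*`-homomorphism on the even part gives a positive functional on the
polynomial algebra of the quantum sphere. -/
theorem state_even_nonneg (φ : PolyRP q →⋆ₐ[ℂ] D) {g : D →L[ℂ] ℂ} (hg : ‖g‖ ≤ 1) (h1 : g 1 = 1)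
    (a : PolySphere q) : 0 ≤ g (φ (even q (star a * a))) := by
  have h := apply_star_mul_self_nonneg hg h1
  simp only [even_star_mul_self, map_add, map_mul, map_star]
  exact add_nonneg (h _) (add_nonneg (h _) (h _))

/-- The letters act contractively, because `h1` and `h2` write `f(x*x)` as a sum of nonnegative
terms that includes the one to be bounded. Products and sums follow by induction. -/
theorem bounded_of_nonneg (f : PolySphere q →ₗ[ℂ] ℂ) (hf : ∀ a, 0 ≤ f (star a * a))
    (a : PolySphere q) :
    ∃ C : ℝ, ∀ x, (f (star (a * x) * (a * x))).re ≤ C * (f (star x * x)).re := by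
  have hre : ∀ a, 0 ≤ (f (star a * a)).re := fun a => (Complex.nonneg_iff.1 (hf a)).1
  have h1 : ∀ x, (f (star x * x)).re
      = (f (star (A * x) * (A * x))).re + (f (star (B * x) * (B * x))).re := fun x => by
    rw [star_mul_self_eq x, map_add, Complex.add_re]
  have h2 : ∀ x, (f (star x * x)).re
      = (f (star (star B * x) * (star B * x))).re + q ^ 4 * (f (star (A * x) * (A * x))).re :=
    fun x => by
      rw [star_mul_self_eq' x, map_add, map_smul, Complex.add_re, smul_eq_mul,
        ← Complex.ofReal_pow, Complex.re_ofReal_mul]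
  obtain ⟨a, rfl⟩ := mk_surjective a
  induction a using FreeStarAlg.induction with
  | h0 r =>
    refine ⟨‖r‖ ^ 2, fun x => le_of_eq ?_⟩
    rw [AlgHom.commutes, ← Algebra.smul_def, star_smul, smul_mul_smul_comm, map_smul, smul_eq_mul,
      Complex.star_def, Complex.conj_mul', ← Complex.ofReal_pow, Complex.re_ofReal_mul]
  | h1 y =>
    refine ⟨1, fun x => ?_⟩
    rw [one_mul]
    rcases y with (_ | _) | (_ | _)
    · change (f (star (A * x) * (A * x))).re ≤ _
      linarith [h1 x, hre (B * x)]
    · change (f (star (B * x) * (B * x))).re ≤ _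
      linarith [h1 x, hre (A * x)]
    · have : (mk (FreeStarAlg.letter (.inr .A)) : PolySphere q) = A := by
        rw [← star_A]
        exact (congrArg mk (FreeStarAlg.star_letter (.inl .A)).symm).trans (star_mk _).symm
      rw [this]
      linarith [h1 x, hre (B * x)]
    · have : (mk (FreeStarAlg.letter (.inr .B)) : PolySphere q) = star B :=
        (congrArg mk (FreeStarAlg.star_letter (.inl .B)).symm).trans (star_mk _).symm
      rw [this]
      have := mul_nonneg (by positivity : 0 ≤ q ^ 4) (hre (A * x))
      linarith [h2 x]
  | h2 a b ha hb =>
    obtain ⟨C, hC⟩ := ha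
    obtain ⟨C', hC'⟩ := hb
    -- A nonnegative first factor is needed to multiply the bound for `b`.
    refine ⟨max C 0 * C', fun x => ?_⟩
    rw [map_mul mk, mul_assoc (mk a), mul_assoc (max C 0)]
    refine (hC _).trans ((mul_le_mul_of_nonneg_right (le_max_left C 0) (hre _)).trans ?_)
    exact mul_le_mul_of_nonneg_left (hC' x) (le_max_right _ _)
  | h3 a b ha hb =>
    obtain ⟨C, hC⟩ := ha
    obtain ⟨C', hC'⟩ := hb
    refine ⟨2 * C + 2 * C', fun x => ?_⟩
    -- Parallelogram identity; dropping the nonnegative difference term bounds the sum, with the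
    -- factors `2`.
    have par : star (mk (a + b) * x) * (mk (a + b) * x)
        + star (mk a * x - mk b * x) * (mk a * x - mk b * x)
        = (2 : ℂ) • (star (mk a * x) * (mk a * x)) + (2 : ℂ) • (star (mk b * x) * (mk b * x))
        := by
      rw [map_add, add_mul]
      simp only [star_add, star_sub, mul_add, add_mul, mul_sub, sub_mul]
      module
    have h := congrArg (fun y => (f y).re) par
    simp only [map_add f, map_smul, Complex.add_re, smul_eq_mul, ← Complex.ofReal_ofNat,
      Complex.re_ofReal_mul] at h
    linarith [hC x, hC' x, hre (mk a * x - mk b * x)]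

/-- The positive functional on the polynomial algebra of the quantum sphere induced by a
`*`-homomorphism of the even part and a state. -/
def inducedFunctional (φ : PolyRP q →⋆ₐ[ℂ] D) {g : D →L[ℂ] ℂ} (hg : ‖g‖ ≤ 1) (h1 : g 1 = 1) :
    BoundedPositiveFunctional (PolySphere q) where
  toLinearMap := g.toLinearMap ∘ₗ (φ : PolyRP q →ₗ[ℂ] D) ∘ₗ even q
  nonneg' := state_even_nonneg φ hg h1
  map_star' a := by
    change g (φ (even q (star a))) = star (g (φ (even q a)))
    rw [even_star, map_star]
    exact apply_star_of_state hg h1 _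
  bounded' := bounded_of_nonneg _ (state_even_nonneg φ hg h1)

/-- Every `*`-homomorphism of the even part to a `C*`-algebra is contractive for the universal
norm of the quantum sphere. -/
theorem norm_map_le_universalNorm (φ : PolyRP q →⋆ₐ[ℂ] D) (a : PolyRP q) :
    ‖φ a‖ ≤ universalNorm (a : PolySphere q) := by
  cases subsingleton_or_nontrivial D
  · rw [Subsingleton.elim (φ a) 0, norm_zero]
    exact universalNorm_nonneg _
  -- On even elements the induced functional is `g ∘ φ`, so the GNS inequality becomes `‖φ(a)‖² ≤
  -- ‖a‖²`. Only `f` is represented on a Hilbert space, so the universe of `D` plays no role.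
  obtain ⟨g, hg, h1, hgd⟩ := exists_state_apply_eq_norm (φ a)
  have h := (inducedFunctional φ hg h1).apply_star_mul_self_le (a : PolySphere q)
  have e1 : (inducedFunctional φ hg h1).toLinearMap 1 = 1 := by
    change g (φ (even q ((1 : PolyRP q) : PolySphere q))) = 1
    rw [even_coe, map_one, h1]
  have e2 : (inducedFunctional φ hg h1).toLinearMap (star (a : PolySphere q) * a)
      = ((‖φ a‖ ^ 2 : ℝ) : ℂ) := by
    change g (φ (even q ((star a * a : PolyRP q) : PolySphere q))) = _
    rw [even_coe, map_mul, map_star, hgd, CStarRing.norm_star_mul_self, sq]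
  rw [e1, e2, Complex.ofReal_re, Complex.one_re, mul_one] at h
  exact (sq_le_sq₀ (norm_nonneg _) (universalNorm_nonneg _)).1 h

end PolySphere

/-! ### Density and comparison of norms -/

theorem norm_rpIncl {q : ℝ} (a : PolyRP q) : ‖rpIncl q a‖ = universalNorm (a : PolySphere q) :=
  CStarCompletion.norm_coe (P := PolySphere q) a

/-- Averaging over the antipode is continuous, fixes invariant elements and sends polynomials to
even polynomials; apply it to a polynomial approximation. -/
theorem denseRange_rpIncl (q : ℝ) : DenseRange (rpIncl q) := by
  have hE : ∀ x : CSphere q, x ∈ CRP q → (2⁻¹ : ℂ) • (x + cAntipode q x) = x := fun x hx => by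
    rw [show cAntipode q x = x from hx]
    module
  have hcont : Continuous fun x : CSphere q => (2⁻¹ : ℂ) • (x + cAntipode q x) :=
    (continuous_id.add
      (CStarCompletion.continuous_map (PolySphere.antipode q))).const_smul (2⁻¹ : ℂ)
  intro x
  rw [closure_subtype, ← hE x x.2]
  refine map_mem_closure (f := fun x : CSphere q => (2⁻¹ : ℂ) • (x + cAntipode q x)) hcont
    (CStarCompletion.denseRange_coe (P := PolySphere q) x) ?_
  rintro _ ⟨a, rfl⟩
  refine ⟨rpIncl q (PolySphere.even q a), ⟨_, rfl⟩, ?_⟩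
  rw [coe_rpIncl, PolySphere.coe_even, map_smul, map_add]
  exact congrArg (fun y => (2⁻¹ : ℂ) • (CStarCompletion.of (PolySphere q) a + y))
    (CStarCompletion.map_of (PolySphere.antipode q) a).symm

/-- The upper bound is the contractivity estimate; it is least because each representation of the
sphere restricts to the even part. -/
theorem isLUB_norm_rpIncl {q : ℝ} (a : PolyRP q) :
    IsLUB (Set.range fun ρ : BoundedRep (PolyRP q) => ‖ρ.π a‖) ‖rpIncl q a‖ := by
  rw [norm_rpIncl]
  constructor
  · rintro _ ⟨ρ, rfl⟩
    exact PolySphere.norm_map_le_universalNorm ρ.π a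
  · intro C hC
    exact ciSup_le fun ρ : BoundedRep (PolySphere q) =>
      hC ⟨{ H := ρ.H, π := ρ.π.comp (PolyRP q).subtype }, rfl⟩

/-! ### Continuous extension and the universal property -/

section Extension

variable {q : ℝ} {D : Type v} [CStarAlgebra D] (φ : PolyRP q →⋆ₐ[ℂ] D)

/-- The continuous linear extension of a `*`-homomorphism. -/
def rpExtendCLM : CRP q →L[ℂ] D :=
  (φ : PolyRP q →ₗ[ℂ] D).extendOfNorm (rpIncl q : PolyRP q →ₗ[ℂ] CRP q)

theorem rpExtendCLM_rpIncl (a : PolyRP q) : rpExtendCLM φ (rpIncl q a) = φ a :=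
  LinearMap.extendOfNorm_eq (f := (φ : PolyRP q →ₗ[ℂ] D))
    (e := (rpIncl q : PolyRP q →ₗ[ℂ] CRP q)) (denseRange_rpIncl q)
    -- Contractivity, with constant `1`, and density are what make the extension agree with `φ`.
    ⟨1, fun x => by
      rw [one_mul]
      exact (PolySphere.norm_map_le_universalNorm φ x).trans_eq (norm_rpIncl x).symm⟩ a

/-- The extension of a `*`-homomorphism of the polynomial algebra of the quantum real projective
plane to its `C*`-algebra. -/
def rpExtend : CRP q →⋆ₐ[ℂ] D where
  toFun := rpExtendCLM φ
  map_one' := by rw [← map_one (rpIncl q), rpExtendCLM_rpIncl, map_one]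
  map_zero' := map_zero _
  map_add' := map_add _
  map_mul' a b := by
    refine (denseRange_rpIncl q).induction_on₂
      (p := fun a b => rpExtendCLM φ (a * b) = rpExtendCLM φ a * rpExtendCLM φ b) ?_ ?_ a b
    · exact isClosed_eq (by fun_prop) (by fun_prop)
    · intro a b
      rw [← map_mul, rpExtendCLM_rpIncl, rpExtendCLM_rpIncl, rpExtendCLM_rpIncl, map_mul]
  commutes' r := by
    rw [← AlgHomClass.commutes (rpIncl q), rpExtendCLM_rpIncl, AlgHomClass.commutes]
  map_star' a := by
    refine (denseRange_rpIncl q).induction_on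
      (p := fun a => rpExtendCLM φ (star a) = star (rpExtendCLM φ a)) a ?_ ?_
    · exact isClosed_eq (by fun_prop) (by fun_prop)
    · intro a
      rw [← map_star, rpExtendCLM_rpIncl, rpExtendCLM_rpIncl, map_star]

end Extension

end

theorem mainTheorem5 (q : ℝ) (hq₀ : 0 < |q|) (hq₁ : |q| < 1) :
    DenseRange (rpIncl q) ∧
    (∀ a : PolyRP q, IsLUB (Set.range fun ρ : BoundedRep (PolyRP q) => ‖ρ.π a‖) ‖rpIncl q a‖) ∧
    (∀ (D : Type v) [CStarAlgebra D] (φ : PolyRP q →⋆ₐ[ℂ] D),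
      ∃! Φ : CRP q →⋆ₐ[ℂ] D, Φ.comp (rpIncl q) = φ) := by
  refine ⟨denseRange_rpIncl q, isLUB_norm_rpIncl, fun D _ φ => ?_⟩
  refine ⟨rpExtend φ, StarAlgHom.ext (rpExtendCLM_rpIncl φ), fun Ψ hΨ => ?_⟩
  -- A `*`-homomorphism between `C*`-algebras is automatically contractive, so agreement on the
  -- dense range decides uniqueness.
  have hΨc : Continuous Ψ := AddMonoidHomClass.continuous_of_bound Ψ 1 fun x => by
    rw [one_mul]
    exact NonUnitalStarAlgHom.norm_apply_le Ψ x
  refine DFunLike.coe_injective ((denseRange_rpIncl q).equalizer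
    hΨc (rpExtendCLM φ).continuous ?_)
  funext a
  exact (DFunLike.congr_fun hΨ a).trans (rpExtendCLM_rpIncl φ a).symm
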